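/- **Theorem 4.2.** For $n\ge 1$ the hypercube $Q_n$ is the graph whose vertices are the subsets of $\{1,\dots,n\}$, two subsets $x,y$ being adjacent if and only if $|x\triangle y|=1$. Let $Q_n^p$ be its $p$-th power: the graph on the same vertices in which two distinct vertices are adjacent if and only if their distance in $Q_n$ is at most $p$. For a finite simple graph $G$, let $\omega(G)$ be its clique number and let $b(G)$ be its b-chromatic number, i.e. the largest $k$ such that $G$ has a proper vertex coloring with $k$ colors in which every color class contains a vertex that has a neighbor in each of the other color classes. (i) Let $n\ge5$ be odd, let $\frac{n+1}{2}\le p\le n-2$, and let $r=\sum_{i=0}^{p-\frac{n-1}{2}}\binom{n}{i}$. Then $$b(Q_n^p)\le 2^{n-1}+\left\lceil\frac r2\right\rceil-1 .$$ (ii) Let $n\ge6$ be even, let $\frac n2+1\le p\le n-2$, and let $r'=\sum_{i=0}^{p-\frac n2}\binom{n}{i}+\binom{n-1}{p-\frac n2}$. Then $$b(Q_n^p)\le 2^{n-1}+\left\lceil\frac {r'}2\right\rceil-1 .$$ In both cases the bound is strictly smaller than the previously known upper bound $2^{n-1}+\left\lfloor\frac{\omega(Q_n^p)}{2}\right\rfloor$.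 -/

import Mathlib

open scoped symmDiff

/-- The hypercube `Q_n`: the vertices are the subsets of an `n`-element set, and two of them
are adjacent iff their symmetric difference has exactly one element. -/
def hypercube (n : ℕ) : SimpleGraph (Finset (Fin n)) where
  Adj x y := (x ∆ y).card = 1
  symm := ⟨fun x y h => by rw [symmDiff_comm]; exact h⟩
  loopless := ⟨fun x h => by simp at h⟩

/-- The `p`-th power `G^p` of a graph: same vertices, and distinct vertices are adjacent iff their
distance in `G` is at most `p` (the distance `edist` is `⊤` between different components). -/
def graphPower {V : Type*} (G : SimpleGraph V) (p : ℕ) : SimpleGraph V where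
  Adj x y := x ≠ y ∧ G.edist x y ≤ p
  symm := ⟨fun x y h => ⟨h.1.symm, by rw [SimpleGraph.edist_comm]; exact h.2⟩⟩
  loopless := ⟨fun x h => h.1 rfl⟩

/-- A proper coloring is a b-coloring if each color `c` has a color dominating vertex: a vertex of
color `c` with a neighbor in each of the other color classes. In particular every color is used. -/
def IsBColoring {V α : Type*} {G : SimpleGraph V} (C : G.Coloring α) : Prop :=
  ∀ c : α, ∃ v : V, C v = c ∧ ∀ d : α, d ≠ c → ∃ w : V, G.Adj v w ∧ C w = d

/-- The b-chromatic number of a (finite) graph: the largest `k` such that `G` has a b-coloring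
using `k` colors. -/
noncomputable def bChromaticNumber {V : Type*} (G : SimpleGraph V) : ℕ :=
  sSup {k : ℕ | ∃ C : G.Coloring (Fin k), IsBColoring C}

/-- The set in the definition of `bChromaticNumber` is bounded for a finite graph. -/
theorem bddAbove_bColoring {V : Type*} [Finite V] (G : SimpleGraph V) :
    BddAbove {k : ℕ | ∃ C : G.Coloring (Fin k), IsBColoring C} := by
  refine ⟨Nat.card V, ?_⟩
  rintro k ⟨C, hC⟩
  have hs : Function.Surjective C := fun c => (hC c).imp fun v hv => hv.1
  simpa using Nat.card_le_card_of_surjective C hs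

/-- The set in the definition of `bChromaticNumber` is nonempty for a finite graph. -/
theorem nonempty_bColoring {V : Type*} [Finite V] (G : SimpleGraph V) :
    {k : ℕ | ∃ C : G.Coloring (Fin k), IsBColoring C}.Nonempty := by
  classical
  cases nonempty_fintype V
  have hex : ∃ k, G.Colorable k := ⟨_, G.colorable_of_fintype⟩
  obtain ⟨C⟩ := Nat.find_spec hex
  refine ⟨Nat.find hex, C, ?_⟩
  by_contra hC
  unfold IsBColoring at hC
  push Not at hC
  obtain ⟨c, hc⟩ := hC
  have : Nonempty (Fin (Nat.find hex)) := ⟨c⟩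
  choose! d hd using hc
  let f : V → {x : Fin (Nat.find hex) // x ≠ c} := fun v =>
    if h : C v = c then ⟨d v, (hd v h).1⟩ else ⟨C v, h⟩
  have hf : ∀ {v w : V}, G.Adj v w → f v ≠ f w := by
    intro v w hvw hEq
    have hne : C v ≠ C w := C.valid hvw
    by_cases hv : C v = c
    · have hw : C w ≠ c := fun h => hne (hv.trans h.symm)
      simp only [f, hv, hw, dite_true, dite_false, Subtype.mk.injEq] at hEq
      exact (hd v hv).2 w hvw hEq.symm
    · by_cases hw : C w = c
      · simp only [f, hv, hw, dite_true, dite_false, Subtype.mk.injEq] at hEq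
        exact (hd w hw).2 v hvw.symm hEq
      · simp only [f, hv, hw, dite_false, Subtype.mk.injEq] at hEq
        exact hne hEq
  have hcol := (SimpleGraph.Coloring.mk f hf).colorable
  have hpos : 0 < Nat.find hex := c.pos
  have hle := Nat.find_min' hex hcol
  rw [Fintype.card_subtype_compl, Fintype.card_fin, Fintype.card_subtype_eq] at hle
  omega

/-- For a finite graph the supremum in `bChromaticNumber` is a maximum. -/
theorem isGreatest_bChromaticNumber {V : Type*} [Finite V] (G : SimpleGraph V) :
    IsGreatest {k : ℕ | ∃ C : G.Coloring (Fin k), IsBColoring C} (bChromaticNumber G) :=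
  ⟨Nat.sSup_mem (nonempty_bColoring G) (bddAbove_bColoring G),
    fun _ hk => le_csSup (bddAbove_bColoring G) hk⟩

/-! In a b-coloring with `k` colors, let `S` be the vertices alone in their class and `T` a choice
of one dominating vertex per color. Each vertex of `T` is within distance `p` of each vertex of `S`,
and `#S ≥ 2k - 2^n`. If `k ≥ 2^(n-1) + ⌈r/2⌉`, then `#S ≥ r` while `#T = k > 2^(n-1)`, so it
suffices to prove an isoperimetric bound: `#S ≥ r` forces `#T ≤ 2^(n-1)`.

Simultaneous UV-compressions replace `S` and `T` by families filled up layer by layer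
(`CrossDiameterLE.exists_isLowerCard`). With `m = ⌊n/2⌋` and `p = a + m`, `S` then contains the ball
of radius `a` about `∅`, so `T` lies in the layers up to `m`. For odd `n` these are half the cube.
For even `n` the extra sets of `S` in layer `a + 1` exclude enough of layer `m` from `T`, by
Kruskal–Katona.

The comparison with the clique number exhibits cliques around a ball. -/

/-! ### Compression of pairs of families with bounded cross-distance -/

section Compression

open Finset UV
open scoped FinsetFamily

variable {α : Type*} [DecidableEq α]

/-- Two families of sets whose members are pairwise at Hamming distance at most `p`. -/
def CrossDiameterLE (p : ℕ) (S T : Finset (Finset α)) : Prop :=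
  ∀ x ∈ S, ∀ y ∈ T, #(x ∆ y) ≤ p

theorem CrossDiameterLE.symm {p : ℕ} {S T : Finset (Finset α)} (h : CrossDiameterLE p S T) :
    CrossDiameterLE p T S := fun x hx y hy => by
  rw [symmDiff_comm]
  exact h y hy x hx

/-- If `y` is also movable, moving `x` or moving `y` gives the same distance. Otherwise, if moving
`x` increases the distance, a strictly smaller compression of `x` already lies at least as far from
`y`. -/
theorem card_symmDiff_compress_le {p : ℕ} {u v x y : Finset α} (huv : Disjoint u v)
    (hlt : #u < #v) (hux : Disjoint u x) (hvx : v ⊆ x) (hxy : #(x ∆ y) ≤ p)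
    (hcomp : Disjoint u y → v ⊆ y → #(x ∆ ((y ∪ u) \ v)) ≤ p)
    (hsub : ∀ u' ⊆ u, ∀ v' ⊆ v, #u' < #v' → #u' + #v' < #u + #v →
      #(((x ∪ u') \ v') ∆ y) ≤ p) :
    #(((x ∪ u) \ v) ∆ y) ≤ p := by
  have hv_mem : ∀ a ∈ v, a ∈ x := hvx
  have hu_mem : ∀ a ∈ u, a ∉ x := fun a h => disjoint_left.1 hux h
  have huv_mem : ∀ a ∈ u, a ∉ v := fun a h => disjoint_left.1 huv h
  by_cases hy : Disjoint u y ∧ v ⊆ y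
  · convert hcomp hy.1 hy.2 using 2
    have hvy : ∀ a ∈ v, a ∈ y := hy.2
    have huy : ∀ a ∈ u, a ∉ y := fun a h => disjoint_left.1 hy.1 h
    ext a
    grind [mem_symmDiff]
  set E := (x ∆ y) \ (u ∪ v) with hE
  have hE_mem : ∀ a, a ∈ E ↔ ((a ∈ x ∧ a ∉ y) ∨ (a ∈ y ∧ a ∉ x)) ∧ a ∉ u ∧ a ∉ v := by
    simp [hE, mem_symmDiff]
  clear_value E
  have e1 : #(x ∆ y) = #E + #(v \ y) + #(u ∩ y) := by
    rw [← card_union_of_disjoint, ← card_union_of_disjoint]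
    · congr 1
      ext a
      grind [mem_symmDiff]
    all_goals
      rw [disjoint_left]
      grind
  have e2 : #(((x ∪ u) \ v) ∆ y) = #E + #(u \ y) + #(v ∩ y) := by
    rw [← card_union_of_disjoint, ← card_union_of_disjoint]
    · congr 1
      ext a
      grind [mem_symmDiff]
    all_goals
      rw [disjoint_left]
      grind
  have hu := card_sdiff_add_card_inter u y
  have hv := card_sdiff_add_card_inter v y
  by_cases hle : #(u \ y) + #(v ∩ y) ≤ #(v \ y) + #(u ∩ y)
  · omega
  -- Swapping `v ∩ y` for part of `u \ y` only creates disagreements with `y`; the cap `#(v ∩ y) -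
  -- 1` keeps `#u' < #v'`.
  obtain ⟨u', hu', hcard⟩ := exists_subset_card_eq (s := u \ y)
    (n := min #(u \ y) (#(v ∩ y) - 1)) (min_le_left _ _)
  have hu'_mem : ∀ a ∈ u', a ∈ u ∧ a ∉ y := fun a h => by simpa using hu' h
  have e3 : #(((x ∪ u') \ (v ∩ y)) ∆ y) = #E + #(v \ y) + #(v ∩ y) + #(u ∩ y) + #u' := by
    rw [← card_union_of_disjoint, ← card_union_of_disjoint, ← card_union_of_disjoint,
      ← card_union_of_disjoint]
    · congr 1
      ext a
      grind [mem_symmDiff]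
    all_goals
      rw [disjoint_left]
      grind
  have hpos : #u' + #(v ∩ y) < #u + #v := by
    by_contra hcon
    refine hy ⟨?_, ?_⟩
    · have : #(u ∩ y) = 0 := by omega
      rwa [card_eq_zero, ← disjoint_iff_inter_eq_empty] at this
    · have : #(v \ y) = 0 := by omega
      rwa [card_eq_zero, sdiff_eq_empty_iff_subset] at this
  have := hsub u' (hu'.trans sdiff_subset) (v ∩ y) inter_subset_left (by omega) hpos
  omega

theorem compress_eq_ite (u v x : Finset α) :
    compress u v x = if Disjoint u x ∧ v ⊆ x then (x ∪ u) \ v else x := rfl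

theorem CrossDiameterLE.card_symmDiff_compress_le {p : ℕ} {S T : Finset (Finset α)}
    {u v x y : Finset α} (h : CrossDiameterLE p S T) (huv : Disjoint u v) (hlt : #u < #v)
    (hS : ∀ u' ⊆ u, ∀ v' ⊆ v, #u' < #v' → #u' + #v' < #u + #v → ∀ x ∈ S, compress u' v' x ∈ S)
    (hx : x ∈ S) (hy : y ∈ T) (hyc : compress u v y ∈ T) :
    #((compress u v x) ∆ y) ≤ p := by
  rw [compress_eq_ite]
  split_ifs with hux
  · refine _root_.card_symmDiff_compress_le huv hlt hux.1 hux.2 (h x hx y hy) ?_ ?_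
    · intro h1 h2
      rw [compress_eq_ite, if_pos ⟨h1, h2⟩] at hyc
      exact h x hx _ hyc
    · intro u' hu' v' hv' h1 h2
      have := hS u' hu' v' hv' h1 h2 x hx
      rw [compress_eq_ite, if_pos ⟨hux.1.mono_left hu', hv'.trans hux.2⟩] at this
      exact h _ this y hy
  · exact h x hx y hy

theorem CrossDiameterLE.compression {p : ℕ} {S T : Finset (Finset α)} {u v : Finset α}
    (h : CrossDiameterLE p S T) (huv : Disjoint u v) (hlt : #u < #v)
    (hS : ∀ u' ⊆ u, ∀ v' ⊆ v, #u' < #v' → #u' + #v' < #u + #v → ∀ x ∈ S, compress u' v' x ∈ S)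
    (hT : ∀ u' ⊆ u, ∀ v' ⊆ v, #u' < #v' → #u' + #v' < #u + #v → ∀ x ∈ T, compress u' v' x ∈ T) :
    CrossDiameterLE p (𝓒 u v S) (𝓒 u v T) := by
  intro x hx y hy
  rw [mem_compression] at hx hy
  obtain ⟨hx, hxc⟩ | ⟨hx, a, ha, rfl⟩ := hx <;> obtain ⟨hy, hyc⟩ | ⟨hy, b, hb, rfl⟩ := hy
  · exact h x hx y hy
  · rw [symmDiff_comm]
    exact h.symm.card_symmDiff_compress_le huv hlt hT hb hx hxc
  · exact h.card_symmDiff_compress_le huv hlt hS ha hy hyc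
  -- Both sets moved: the same translation is applied to each, so the distance is unchanged.
  · have hax : Disjoint u a ∧ v ⊆ a := by
      by_contra hc
      rw [compress_eq_ite, if_neg hc] at hx
      exact hx ha
    have hby : Disjoint u b ∧ v ⊆ b := by
      by_contra hc
      rw [compress_eq_ite, if_neg hc] at hy
      exact hy hb
    convert h a ha b hb using 2
    rw [compress_eq_ite, if_pos hax, compress_eq_ite, if_pos hby]
    have hva : ∀ i ∈ v, i ∈ a := hax.2
    have hvb : ∀ i ∈ v, i ∈ b := hby.2
    have hua : ∀ i ∈ u, i ∉ a := fun i h => disjoint_left.1 hax.1 h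
    have hub : ∀ i ∈ u, i ∉ b := fun i h => disjoint_left.1 hby.1 h
    ext i
    grind [mem_symmDiff]

theorem card_compress_le {u v : Finset α} (hlt : #u < #v) (x : Finset α) :
    #(compress u v x) ≤ #x ∧ (compress u v x ≠ x → #(compress u v x) < #x) := by
  rw [compress_eq_ite]
  split_ifs with h
  · have : #((x ∪ u) \ v) < #x := by
      rw [card_sdiff_of_subset (h.2.trans subset_union_left), card_union_of_disjoint h.1.symm]
      have := card_le_card h.2
      omega
    exact ⟨this.le, fun _ => this⟩
  · simp

theorem sum_card_compression (u v : Finset α) (S : Finset (Finset α)) :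
    ∑ x ∈ 𝓒 u v S, #x = ∑ x ∈ S with compress u v x ∈ S, #x +
      ∑ x ∈ S with compress u v x ∉ S, #(compress u v x) := by
  rw [UV.compression, sum_union compress_disjoint, filter_image, sum_image compress_injOn]

theorem sum_card_compression_le {u v : Finset α} (hlt : #u < #v) (S : Finset (Finset α)) :
    ∑ x ∈ 𝓒 u v S, #x ≤ ∑ x ∈ S, #x := by
  rw [sum_card_compression, ← sum_filter_add_sum_filter_not S (fun x => compress u v x ∈ S)]
  exact Nat.add_le_add_left (sum_le_sum fun x _ => (card_compress_le hlt x).1) _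

theorem compress_mem_of_sum_card_le {u v : Finset α} (hlt : #u < #v) {S : Finset (Finset α)}
    (h : ∑ x ∈ S, #x ≤ ∑ x ∈ 𝓒 u v S, #x) : ∀ x ∈ S, compress u v x ∈ S := by
  intro x hx
  by_contra hc
  refine h.not_gt ?_
  rw [sum_card_compression, ← sum_filter_add_sum_filter_not S (fun x => compress u v x ∈ S)]
  gcongr 1
  refine sum_lt_sum (fun y _ => (card_compress_le hlt y).1) ⟨x, by simp [hx, hc], ?_⟩
  exact (card_compress_le hlt x).2 fun h => hc (by rwa [h])

/-- A family of sets containing, with each member, every set of smaller cardinality. -/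
def IsLowerCard (S : Finset (Finset α)) : Prop :=
  ∀ x ∈ S, ∀ y, #y < #x → y ∈ S

/-- Take a pair minimizing the total size of all members. Strong induction on `#u + #v` shows it
stable under every compression with `#u < #v`, and compressing `x` along `y \ x`, `x \ y` yields
`y`. -/
theorem CrossDiameterLE.exists_isLowerCard {p : ℕ} {S T : Finset (Finset α)}
    (h : CrossDiameterLE p S T) :
    ∃ S' T' : Finset (Finset α), CrossDiameterLE p S' T' ∧ #S' = #S ∧ #T' = #T ∧
      IsLowerCard S' ∧ IsLowerCard T' := by
  let P : ℕ → Prop := fun w => ∃ S' T' : Finset (Finset α), CrossDiameterLE p S' T' ∧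
    #S' = #S ∧ #T' = #T ∧ ∑ x ∈ S', #x + ∑ x ∈ T', #x = w
  have hP : ∃ w, P w := ⟨_, S, T, h, rfl, rfl, rfl⟩
  classical
  obtain ⟨S', T', hc, hS, hT, hw⟩ := Nat.find_spec hP
  have key : ∀ m, ∀ u v : Finset α, #u + #v = m → Disjoint u v → #u < #v →
      (∀ x ∈ S', compress u v x ∈ S') ∧ (∀ x ∈ T', compress u v x ∈ T') := by
    intro m
    induction m using Nat.strong_induction_on with
    | _ m ih =>
      intro u v hm huv hlt
      have hcc := hc.compression huv hlt
        (fun u' hu' v' hv' h1 h2 => (ih _ (hm ▸ h2) u' v' rfl (huv.mono hu' hv') h1).1)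
        (fun u' hu' v' hv' h1 h2 => (ih _ (hm ▸ h2) u' v' rfl (huv.mono hu' hv') h1).2)
      have hmin : Nat.find hP ≤ _ := Nat.find_min' hP
        ⟨_, _, hcc, (card_compression _ _ _).trans hS, (card_compression _ _ _).trans hT, rfl⟩
      have h1 := sum_card_compression_le hlt S'
      have h2 := sum_card_compression_le hlt T'
      exact ⟨compress_mem_of_sum_card_le hlt (by omega),
        compress_mem_of_sum_card_le hlt (by omega)⟩
  have hlow : ∀ x y : Finset α, #y < #x → #(y \ x) < #(x \ y) := fun x y hxy => by
    have := card_sdiff_add_card_inter x y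
    have := card_sdiff_add_card_inter y x
    rw [inter_comm] at this
    omega
  refine ⟨S', T', hc, hS, hT, fun x hx y hxy => ?_, fun x hx y hxy => ?_⟩
  · simpa using (key _ (y \ x) (x \ y) rfl (disjoint_sdiff_sdiff) (hlow x y hxy)).1 x hx
  · simpa using (key _ (y \ x) (x \ y) rfl (disjoint_sdiff_sdiff) (hlow x y hxy)).2 x hx

end Compression

/-! ### Isoperimetric bounds for a pair of families -/

section Isoperimetry

open Finset
open scoped FinsetFamily

theorem card_filter_card_lt (n a : ℕ) :
    #{x : Finset (Fin n) | #x < a} = ∑ i ∈ range a, n.choose i := by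
  rw [card_eq_sum_card_fiberwise (f := card) (t := range a) (fun x hx => by simpa using hx)]
  refine sum_congr rfl fun i hi => ?_
  rw [← card_fin n, ← card_powersetCard, card_fin]
  congr 1
  ext x
  simp only [mem_filter, mem_univ, true_and, mem_powersetCard, subset_univ]
  exact ⟨And.right, fun h => ⟨h ▸ mem_range.1 hi, h⟩⟩

theorem card_filter_card_eq (n a : ℕ) : #{x : Finset (Fin n) | #x = a} = n.choose a := by
  rw [← card_fin n, ← card_powersetCard, card_fin]
  congr 1
  ext x
  simp [mem_powersetCard]

theorem sum_range_succ_choose_add_choose (n a : ℕ) :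
    ∑ i ∈ range (a + 1), (n + 1).choose i + n.choose a = 2 * ∑ i ∈ range (a + 1), n.choose i := by
  induction a with
  | zero => simp
  | succ a ih =>
    rw [sum_range_succ, sum_range_succ (fun i => n.choose i), Nat.choose_succ_succ, mul_add, ← ih]
    ring

variable {n p : ℕ} {S T : Finset (Finset (Fin n))}

theorem IsLowerCard.mem_of_card_le {a : ℕ} (hS : IsLowerCard S)
    (hcard : ∑ i ∈ range (a + 1), n.choose i ≤ #S) {y : Finset (Fin n)} (hy : #y ≤ a) : y ∈ S := by
  by_contra hyS
  rw [← card_filter_card_lt] at hcard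
  refine hcard.not_gt (card_lt_card ⟨fun x hx => ?_, fun h => hyS (h ?_)⟩)
  · have := mt (hS x hx y) hyS
    simp only [mem_filter, mem_univ, true_and]
    omega
  · simp only [mem_filter, mem_univ, true_and]
    omega

theorem card_symmDiff_of_disjoint {α : Type*} [DecidableEq α] {x y : Finset α}
    (h : Disjoint x y) : #(x ∆ y) = #x + #y := by
  rw [h.symmDiff_eq_sup, sup_eq_union, card_union_of_disjoint h]

theorem CrossDiameterLE.card_add_le {a : ℕ} (h : CrossDiameterLE p S T) (hp : p < n)
    (hS : ∀ x : Finset (Fin n), #x ≤ a → x ∈ S) {y : Finset (Fin n)} (hy : y ∈ T) :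
    a + #y ≤ p := by
  have hc : #yᶜ = n - #y := by simp [card_compl]
  have hn : #y ≤ n := by simpa using card_le_univ y
  by_cases ha : a ≤ #yᶜ
  · obtain ⟨x, hx, rfl⟩ := exists_subset_card_eq ha
    have := h x (hS x le_rfl) y hy
    rwa [card_symmDiff_of_disjoint (disjoint_compl_left.mono_left hx)] at this
  -- Here `yᶜ` itself lies in `S`, at distance `n > p` from `y`.
  · have := h yᶜ (hS _ (by omega)) y hy
    rw [card_symmDiff_of_disjoint disjoint_compl_left] at this
    omega

theorem CrossDiameterLE.card_le_of_odd {m a : ℕ} (hn : n = 2 * m + 1) (hp : p = a + m)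
    (hpn : p < n) (h : CrossDiameterLE p S T)
    (hcard : ∑ i ∈ range (a + 1), n.choose i ≤ #S) : #T ≤ 2 ^ (n - 1) := by
  obtain ⟨S', T', h', hS, hT, hlS, -⟩ := h.exists_isLowerCard
  rw [← hS] at hcard
  rw [← hT]
  calc #T' ≤ #{x : Finset (Fin n) | #x < m + 1} := by
        refine card_le_card fun y hy => ?_
        have := h'.card_add_le hpn (fun x hx => hlS.mem_of_card_le hcard hx) hy
        simp only [mem_filter, mem_univ, true_and]
        omega
    _ = 4 ^ m := by rw [card_filter_card_lt, hn, Nat.sum_range_choose_halfway]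
    _ = 2 ^ (n - 1) := by rw [hn, Nat.add_sub_cancel, pow_mul]; norm_num

/-- Either layer `a + 1` is full, or a missing set there keeps `S` within the layers up to `a + 1`.
-/
theorem IsLowerCard.choose_le_card_filter {k a : ℕ} (hn : n = k + 1) (hS : IsLowerCard S)
    (hcard : ∑ i ∈ range (a + 1), n.choose i + k.choose a ≤ #S) :
    k.choose a ≤ #{x ∈ S | #x = a + 1} := by
  by_cases hball : ∀ x : Finset (Fin n), #x = a + 1 → x ∈ S
  · have : S.filter (fun x => #x = a + 1) = univ.filter (fun x : Finset (Fin n) => #x = a + 1) := by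
      ext x
      simpa using hball x
    rw [this, card_filter_card_eq, hn, Nat.choose_succ_succ]
    omega
  · push Not at hball
    obtain ⟨x₀, hx₀, hx₀S⟩ := hball
    have hsub : S ⊆ ({x : Finset (Fin n) | #x < a + 1} : Finset _) ∪ {x ∈ S | #x = a + 1} := by
      intro x hx
      have := mt (hS x hx x₀) hx₀S
      simp only [mem_union, mem_filter, mem_univ, true_and, hx]
      omega
    have := (card_le_card hsub).trans (card_union_le _ _)
    rw [card_filter_card_lt] at this
    omega

theorem CrossDiameterLE.card_le_of_even {m a : ℕ} (hn : n = 2 * m) (hp : p = a + m)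
    (hpn : p < n) (h : CrossDiameterLE p S T)
    (hcard : ∑ i ∈ range (a + 1), n.choose i + (n - 1).choose a ≤ #S) : #T ≤ 2 ^ (n - 1) := by
  obtain ⟨S', T', h', hS, hT, hlS, -⟩ := h.exists_isLowerCard
  rw [← hS] at hcard
  rw [← hT]
  obtain ⟨l, rfl⟩ : ∃ l, m = l + 1 := ⟨m - 1, by omega⟩
  have hF := hlS.choose_le_card_filter (k := n - 1) (by omega) hcard
  set F : Finset (Finset (Fin n)) := {x ∈ S' | #x = a + 1} with hFdef
  -- A set of size `l + 1` disjoint from some `x ∈ F` is at distance `p + 1` from it, hence not in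
  -- `T'`. Such sets form the `(l - a)`-fold shadow of the complements of `F`.
  have hsized : ((Fᶜˢ : Finset (Finset (Fin n))) : Set (Finset (Fin n))).Sized (n - (a + 1)) := by
    intro x hx
    rw [mem_coe, mem_compls, hFdef, mem_filter, card_compl, Fintype.card_fin] at hx
    have : #x ≤ n := by simpa using card_le_univ x
    omega
  have hKK := kruskal_katona_lovasz_form (i := l - a) (k := n - 1) (by omega) (by omega) (by omega)
    hsized (by
      rw [card_compls, ← Nat.choose_symm_of_eq_add (show n - 1 = a + (n - (a + 1)) by omega)]
      exact hF)
  have hshadow : ∀ z ∈ ∂^[l - a] Fᶜˢ, #z = l + 1 ∧ z ∉ T' := by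
    intro z hz
    obtain ⟨x, hx, hzx, hcx⟩ := mem_shadow_iterate_iff_exists_mem_card_add.1 hz
    have := hsized hx
    rw [mem_compls, hFdef, mem_filter] at hx
    refine ⟨by omega, fun hzT => ?_⟩
    have := h' _ hx.1 z hzT
    rw [card_symmDiff_of_disjoint (disjoint_compl_left.mono_right hzx)] at this
    omega
  have hsub : T' ⊆ ({x : Finset (Fin n) | #x < l + 1} : Finset _) ∪
      ({x : Finset (Fin n) | #x = l + 1} : Finset _) \ ∂^[l - a] Fᶜˢ := by
    intro y hy
    have := h'.card_add_le hpn
      (fun x hx => hlS.mem_of_card_le ((Nat.le_add_right _ _).trans hcard) hx) hy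
    have hyn : y ∉ ∂^[l - a] Fᶜˢ := fun hc => (hshadow y hc).2 hy
    simp only [mem_union, mem_sdiff, mem_filter, mem_univ, true_and, hyn, not_false_eq_true,
      and_true]
    omega
  have hT' := (card_le_card hsub).trans (card_union_le _ _)
  rw [card_sdiff_of_subset (fun z hz => by simpa using (hshadow z hz).1), card_filter_card_lt,
    card_filter_card_eq] at hT'
  -- The layers below the middle, plus the middle layer less `(n - 1).choose (l + 1)`, make exactly
  -- half the cube.
  have hid := sum_range_succ_choose_add_choose (2 * l + 1) l
  rw [Nat.sum_range_choose_halfway, show 2 * l + 1 + 1 = n by omega] at hid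
  have hpas := Nat.choose_succ_succ (2 * l + 1) l
  rw [show (2 * l + 1).succ = n by omega] at hpas
  rw [show n - (a + 1) - (l - a) = l + 1 by omega, show n - 1 = 2 * l + 1 by omega] at hKK
  have hpow : 2 ^ (n - 1) = 2 * 4 ^ l := by
    rw [show n - 1 = 2 * l + 1 by omega, pow_succ, pow_mul]
    norm_num [mul_comm]
  simp only [Nat.succ_eq_add_one] at hpas
  omega

end Isoperimetry

/-! ### From b-colorings and cliques to cross-distance -/

section HypercubePower

open Finset

theorem exists_hypercube_walk {n : ℕ} (k : ℕ) (x y : Finset (Fin n)) (h : #(x ∆ y) = k) :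
    ∃ w : (hypercube n).Walk x y, w.length = k := by
  induction k generalizing x with
  | zero =>
    rw [card_eq_zero, ← bot_eq_empty, symmDiff_eq_bot] at h
    subst h
    exact ⟨.nil, rfl⟩
  | succ k ih =>
    obtain ⟨i, hi⟩ := card_pos.1 (by omega : 0 < #(x ∆ y))
    have hz : (x ∆ {i}) ∆ y = (x ∆ y).erase i := by
      ext j
      by_cases hj : j = i
      · subst hj
        simp only [mem_symmDiff, mem_singleton, mem_erase] at hi ⊢
        tauto
      · simp [mem_symmDiff, hj]
    obtain ⟨w, hw⟩ := ih (x ∆ {i}) (by rw [hz, card_erase_of_mem hi, h, Nat.add_sub_cancel])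
    refine ⟨.cons (v := x ∆ {i}) ?_ w, ?_⟩
    · change #(x ∆ (x ∆ {i})) = 1
      rw [symmDiff_symmDiff_cancel_left, card_singleton]
    · rw [SimpleGraph.Walk.length_cons, hw]

theorem card_symmDiff_le_length {n : ℕ} {x y : Finset (Fin n)} (w : (hypercube n).Walk x y) :
    #(x ∆ y) ≤ w.length := by
  induction w with
  | nil => simp
  | @cons x z y h w ih =>
    have h1 : #(x ∆ z) = 1 := h
    have h2 : x ∆ y ⊆ (x ∆ z) ∪ (z ∆ y) := symmDiff_triangle x z y
    have := (card_le_card h2).trans (card_union_le _ _)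
    rw [SimpleGraph.Walk.length_cons]
    omega

theorem hypercube_edist {n : ℕ} (x y : Finset (Fin n)) :
    (hypercube n).edist x y = #(x ∆ y) := by
  obtain ⟨w, hw⟩ := exists_hypercube_walk _ x y rfl
  refine le_antisymm (hw ▸ w.edist_le) (le_iInf fun w => ?_)
  exact_mod_cast card_symmDiff_le_length w

theorem graphPower_hypercube_adj {n p : ℕ} {x y : Finset (Fin n)} :
    (graphPower (hypercube n) p).Adj x y ↔ x ≠ y ∧ #(x ∆ y) ≤ p := by
  change x ≠ y ∧ (hypercube n).edist x y ≤ p ↔ _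
  rw [hypercube_edist, Nat.cast_le]

/-- Each fiber has at least two points, or one point that is counted twice on the right. -/
theorem card_fiber_eq_one_lower_bound {V : Type*} [Fintype V] [DecidableEq V] {k : ℕ}
    (f : V → Fin k) (hf : Function.Surjective f) :
    2 * k ≤ Fintype.card V + #{v : V | ∀ w, f w = f v → w = v} := by
  have hfib : ∀ c : Fin k, 2 ≤ #{v : V | f v = c} +
      #{v : V | (∀ w, f w = f v → w = v) ∧ f v = c} := by
    intro c
    obtain ⟨v, hv⟩ := hf c
    have h1 : 0 < #{v : V | f v = c} := card_pos.2 ⟨v, by simpa using hv⟩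
    by_cases h : 1 < #{v : V | f v = c}
    · omega
    · have h2 : 0 < #{v : V | (∀ w, f w = f v → w = v) ∧ f v = c} := by
        refine card_pos.2 ⟨v, ?_⟩
        have := card_le_one.1 (not_lt.1 h)
        simp only [mem_filter, mem_univ, true_and] at this ⊢
        exact ⟨fun w hw => this w (hw.trans hv) v hv, hv⟩
      omega
  have hsum := sum_le_sum (s := univ) fun c _ => hfib c
  rw [sum_add_distrib] at hsum
  rw [← card_univ (α := V),
    card_eq_sum_card_fiberwise (s := univ) (f := f) (t := univ) (by simp),
    card_eq_sum_card_fiberwise (s := {v : V | ∀ w, f w = f v → w = v}) (f := f) (t := univ)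
      (by simp)]
  simp only [filter_filter]
  refine le_trans ?_ hsum
  simp [mul_comm]

theorem bChromaticNumber_graphPower_hypercube_lt {n p r : ℕ} (hn : 1 ≤ n) (hr : 1 ≤ r)
    (hiso : ∀ S T : Finset (Finset (Fin n)), CrossDiameterLE p S T → r ≤ #S → #T ≤ 2 ^ (n - 1)) :
    bChromaticNumber (graphPower (hypercube n) p) < 2 ^ (n - 1) + ⌈(r : ℚ) / 2⌉₊ := by
  obtain ⟨C, hC⟩ := (isGreatest_bChromaticNumber (graphPower (hypercube n) p)).1
  generalize bChromaticNumber (graphPower (hypercube n) p) = k at C hC ⊢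
  by_contra! hk
  have hceil : (r : ℚ) / 2 ≤ ⌈(r : ℚ) / 2⌉₊ := Nat.le_ceil _
  have hceil' : r ≤ 2 * ⌈(r : ℚ) / 2⌉₊ := by
    have : (r : ℚ) ≤ 2 * ⌈(r : ℚ) / 2⌉₊ := by linarith
    exact_mod_cast this
  have hpow : 2 ^ n = 2 * 2 ^ (n - 1) := by
    rw [← pow_succ', Nat.sub_add_cancel hn]
  have hsing := card_fiber_eq_one_lower_bound C (fun c => (hC c).imp fun v hv => hv.1)
  rw [Fintype.card_finset, Fintype.card_fin] at hsing
  choose b hb hdom using hC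
  have hinj : Function.Injective b := fun c d h => by rw [← hb c, h, hb d]
  have hT := hiso {v | ∀ w, C w = C v → w = v} (univ.image b) (by
    intro x hx y hy
    obtain ⟨c, -, rfl⟩ := mem_image.1 hy
    simp only [mem_filter, mem_univ, true_and] at hx
    by_cases hxc : C x = c
    · rw [hx (b c) ((hb c).trans hxc.symm)]
      simp
    · obtain ⟨w, hw, hwx⟩ := hdom c (C x) hxc
      rw [hx w hwx, graphPower_hypercube_adj] at hw
      rw [symmDiff_comm]
      exact hw.2) (by omega)
  rw [card_image_of_injective _ hinj, card_univ, Fintype.card_fin] at hT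
  omega

theorem card_le_cliqueNum {n p : ℕ} {S : Finset (Finset (Fin n))} (h : CrossDiameterLE p S S) :
    #S ≤ (graphPower (hypercube n) p).cliqueNum := by
  refine SimpleGraph.IsClique.card_le_cliqueNum (tc := fun x hx y hy hxy => ?_)
  exact graphPower_hypercube_adj.2 ⟨hxy, h x hx y hy⟩

theorem card_symmDiff_le {α : Type*} [DecidableEq α] (x y : Finset α) : #(x ∆ y) ≤ #x + #y :=
  (card_le_card (symmDiff_le_sup (a := x) (b := y))).trans (card_union_le x y)

theorem sum_choose_le_cliqueNum {n p a : ℕ} (hp : 2 * a ≤ p) :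
    ∑ i ∈ range (a + 1), n.choose i ≤ (graphPower (hypercube n) p).cliqueNum := by
  rw [← card_filter_card_lt]
  refine card_le_cliqueNum fun x hx y hy => ?_
  simp only [mem_filter, mem_univ, true_and] at hx hy
  have := card_symmDiff_le x y
  omega

theorem sum_choose_lt_cliqueNum {n p a : ℕ} (hp : 2 * a < p) (ha : a < n) :
    ∑ i ∈ range (a + 1), n.choose i < (graphPower (hypercube n) p).cliqueNum := by
  obtain ⟨z, -, hz⟩ := exists_subset_card_eq (s := (univ : Finset (Fin n))) (n := a + 1)
    (by simpa using ha)
  have hclique := card_le_cliqueNum (n := n) (p := p)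
    (S := insert z ({x : Finset (Fin n) | #x < a + 1} : Finset _)) (by
      intro x hx y hy
      simp only [mem_insert, mem_filter, mem_univ, true_and] at hx hy
      have := card_symmDiff_le x y
      obtain rfl | hx := hx <;> obtain rfl | hy := hy
      · simp
      all_goals omega)
  rwa [card_insert_of_notMem (by simp [hz]), card_filter_card_lt] at hclique

theorem ceil_half_le_floor_half {r w : ℕ} (h : r < w) :
    ⌈(r : ℚ) / 2⌉₊ ≤ ⌊(w : ℚ) / 2⌋₊ := by
  have h1 : ⌊(w : ℚ) / 2⌋₊ = w / 2 := by exact_mod_cast Nat.floor_div_eq_div (K := ℚ) w 2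
  rw [h1, Nat.ceil_le, div_le_iff₀ (by norm_num)]
  norm_cast
  omega

theorem bChromaticNumber_le_and_lt {n p r : ℕ} (hn : 1 ≤ n) (hr : 1 ≤ r)
    (hiso : ∀ S T : Finset (Finset (Fin n)), CrossDiameterLE p S T → r ≤ #S → #T ≤ 2 ^ (n - 1))
    (hω : r < (graphPower (hypercube n) p).cliqueNum) :
    bChromaticNumber (graphPower (hypercube n) p) ≤ 2 ^ (n - 1) + ⌈(r : ℚ) / 2⌉₊ - 1 ∧
      2 ^ (n - 1) + ⌈(r : ℚ) / 2⌉₊ - 1 <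
        2 ^ (n - 1) + ⌊((graphPower (hypercube n) p).cliqueNum : ℚ) / 2⌋₊ := by
  have h1 := bChromaticNumber_graphPower_hypercube_lt hn hr hiso
  have h2 := ceil_half_le_floor_half hω
  omega

theorem one_le_sum_choose (n a : ℕ) : 1 ≤ ∑ i ∈ range (a + 1), n.choose i := by
  rw [sum_range_succ', Nat.choose_zero_right]
  omega

end HypercubePower

theorem theorem4p2 (n p : ℕ) :
    (Odd n → 5 ≤ n → (n + 1) / 2 ≤ p → p ≤ n - 2 →
      ∀ r : ℕ, r = ∑ i ∈ Finset.range (p - (n - 1) / 2 + 1), n.choose i →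
        bChromaticNumber (graphPower (hypercube n) p) ≤ 2 ^ (n - 1) + ⌈(r : ℚ) / 2⌉₊ - 1 ∧
        2 ^ (n - 1) + ⌈(r : ℚ) / 2⌉₊ - 1 <
          2 ^ (n - 1) + ⌊((graphPower (hypercube n) p).cliqueNum : ℚ) / 2⌋₊) ∧
    (Even n → 6 ≤ n → n / 2 + 1 ≤ p → p ≤ n - 2 →
      ∀ r' : ℕ, r' = (∑ i ∈ Finset.range (p - n / 2 + 1), n.choose i)
          + (n - 1).choose (p - n / 2) →
        bChromaticNumber (graphPower (hypercube n) p) ≤ 2 ^ (n - 1) + ⌈(r' : ℚ) / 2⌉₊ - 1 ∧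
        2 ^ (n - 1) + ⌈(r' : ℚ) / 2⌉₊ - 1 <
          2 ^ (n - 1) + ⌊((graphPower (hypercube n) p).cliqueNum : ℚ) / 2⌋₊) := by
  constructor
  · rintro ⟨m, hm⟩ hn hp hpn r rfl
    refine bChromaticNumber_le_and_lt (by omega) (one_le_sum_choose _ _) (fun S T h hS => ?_)
      (sum_choose_lt_cliqueNum (by omega) (by omega))
    exact h.card_le_of_odd hm (by omega) (by omega) hS
  · rintro ⟨m, hm⟩ hn hp hpn r rfl
    refine bChromaticNumber_le_and_lt (by omega) (le_add_right (one_le_sum_choose _ _))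
      (fun S T h hS => h.card_le_of_even (m := m) (by omega) (by omega) (by omega) hS) ?_
    -- The ball one radius larger is still a clique since `p ≤ n - 2`; by Pascal's rule its outer
    -- layer exceeds the extra term of `r'`.
    refine lt_of_lt_of_le ?_ (sum_choose_le_cliqueNum (a := p - n / 2 + 1) (by omega))
    obtain ⟨l, rfl⟩ : ∃ l, n = l + 1 := ⟨n - 1, by omega⟩
    rw [Finset.sum_range_succ _ (p - (l + 1) / 2 + 1), Nat.add_sub_cancel,
      Nat.choose_succ_succ l (p - (l + 1) / 2)]
    have := Nat.choose_pos (show (p - (l + 1) / 2).succ ≤ l by omega)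
    omega
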